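/- Let $d\ge 1$ and $s\ge 1$ be integers, let $\beta>-d-s$ be real and let $\lambda_0,\dots,\lambda_{s-1}>0$. Let $\mathbb V=\{(x,t)\in\mathbb R^d\times\mathbb R:\ \|x\|=t,\ 0\le t\le 1\}$ be the conic surface, with the measure $\mathsf m$ given by $$\int_{\mathbb V} f\,d\mathsf m=\int_0^1 t^{d-1}\int_{\mathbb S^{d-1}} f(t\xi,t)\,d\sigma(\xi)\,dt,$$ where $\sigma$ is the surface measure of the unit sphere $\mathbb S^{d-1}$ (counting measure if $d=1$), and let $\omega_d=\sigma(\mathbb S^{d-1})$. For functions $f(x,t)$ on $\mathbb R^d\times\mathbb R$, $\partial_t$ denotes the partial derivative in $t$ with $x$ held fixed. For $\alpha>-d$, $\gamma>-1$ put $w_{\alpha,\gamma}(t)=t^{\alpha}(1-t)^{\gamma}$ and $$\langle f,g\rangle_{\alpha,\gamma}=b_{\alpha,\gamma}\int_{\mathbb V} f g\, w_{\alpha,\gamma}(t)\,d\mathsf m,\qquad b_{\alpha,\gamma}=\frac1{\omega_d}\frac{\Gamma(\alpha+\gamma+d+1)}{\Gamma(\alpha+d)\Gamma(\gamma+1)}$$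 (so that $\langle 1,1\rangle_{\alpha,\gamma}=1$), and let $$\langle f,g\rangle_{\beta,-s}=\frac1{\omega_d}\int_{\mathbb V}\partial_t^s f\,\partial_t^s g\;t^{\beta+s}\,d\mathsf m+\sum_{k=0}^{s-1}\frac{\lambda_k}{\omega_d}\int_{\mathbb S^{d-1}}\partial_t^k f(\xi,1)\,\partial_t^k g(\xi,1)\,d\sigma(\xi).$$ Let $\Pi_n$ be the linear span of the functions $(x,t)\mapsto t^jY(x)$, where $Y$ is a solid harmonic (a homogeneous polynomial on $\mathbb R^d$ with $\Delta Y=0$) of degree $m$ and $j+m\le n$; these are the representatives, harmonic in $x$, of the polynomials of degree at most $n$ on $\mathbb V$, that is, modulo the ideal generated by $t^2-\|x\|^2$. For each of the two forms, the space of orthogonal polynomials of degree $n$ consists of the $P\in\Pi_n$ that are orthogonal to $\Pi_k$ for all $k<n$, and $\operatorname{proj}_n^{\beta,-s}$, respectively $\operatorname{proj}_n^{\alpha,\gamma}$, denotes the orthogonal projection onto this space: $P=\operatorname{proj}_n f$ means that $P$ is in the space and $f-P$ is orthogonal to it. Let $f:\mathbb R^d\times\mathbb R\to\mathbb R$ be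 $s$ times differentiable in $t$ on an open set containing $\mathbb V\setminus\{(0,0)\}$, with $\partial_t^s f\in L^2(\mathbb V,w_{\beta+s,0})$ and $\partial_t^k f(\cdot,1)\in L^2(\mathbb S^{d-1})$ for $0\le k<s$. Then, for every $n\ge s$, the projections $\operatorname{proj}_n^{\beta,-s}f$ and $\operatorname{proj}_{n-s}^{\beta+s,0}(\partial_t^s f)$ exist and are unique, and $$\partial_t^s\operatorname{proj}_n^{\beta,-s}f=\operatorname{proj}_{n-s}^{\beta+s,0}(\partial_t^s f),$$ as polynomials in $(x,t)$, and hence in particular on $\mathbb V$. -/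

import Mathlib

open MeasureTheory

noncomputable section

/-- Real-valued functions of `(x, t)` with `x ∈ ℝ^d` and `t ∈ ℝ`. -/
abbrev ConeFun (d : ℕ) : Type := EuclideanSpace ℝ (Fin d) × ℝ → ℝ

/-- The partial derivative `∂_t^k f`, taken in the last variable `t` with `x` held fixed. -/
def tDeriv {d : ℕ} (k : ℕ) (f : ConeFun d) : ConeFun d :=
  fun z => iteratedDeriv k (fun v : ℝ => f (z.1, v)) z.2

/-- `f` is `s` times differentiable in the variable `t` on some open set containing the conic
surface `{(x, t) : ‖x‖ = t, 0 < t ≤ 1}` (nothing is required at the apex). -/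
def TDifferentiableNearCone {d : ℕ} (s : ℕ) (f : ConeFun d) : Prop :=
  ∃ U : Set (EuclideanSpace ℝ (Fin d) × ℝ), IsOpen U ∧
    (∀ z : EuclideanSpace ℝ (Fin d) × ℝ, ‖z.1‖ = z.2 → 0 < z.2 → z.2 ≤ 1 → z ∈ U) ∧
    ∀ z ∈ U, ∀ k < s, DifferentiableAt ℝ (iteratedDeriv k (fun v : ℝ => f (z.1, v))) z.2

/-- The surface measure `σ` of the unit sphere of `ℝ^d`. -/
def sphereMeasure (d : ℕ) : Measure (Metric.sphere (0 : EuclideanSpace ℝ (Fin d)) 1) :=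
  (volume : Measure (EuclideanSpace ℝ (Fin d))).toSphere

/-- The surface area `ω_d` of the unit sphere of `ℝ^d`. -/
def sphereArea (d : ℕ) : ℝ := (sphereMeasure d).real Set.univ

/-- The measure `m` on the conic surface `‖x‖ = t`, `0 ≤ t ≤ 1`, regarded as a measure on
`ℝ^d × ℝ`: `∫ f dm = ∫_0^1 t^(d-1) ∫_{S^(d-1)} f(t ξ, t) dσ(ξ) dt`. -/
def coneMeasure (d : ℕ) : Measure (EuclideanSpace ℝ (Fin d) × ℝ) :=
  ((((volume : Measure ℝ).restrict (Set.Ioc 0 1)).withDensity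
      (fun t => ENNReal.ofReal (t ^ (d - 1)))).prod (sphereMeasure d)).map
    (fun p => (p.1 • (p.2 : EuclideanSpace ℝ (Fin d)), p.1))

/-- The Jacobi weight `w_{β,γ}(t) = t^β (1 - t)^γ`. -/
def jacobiWeight (β γ t : ℝ) : ℝ := t ^ β * (1 - t) ^ γ

/-- Membership in `L²(V, w_{β,γ})`, where `V` is the conic surface. -/
def MemL2Cone {d : ℕ} (β γ : ℝ) (f : ConeFun d) : Prop :=
  MemLp f 2 ((coneMeasure d).withDensity (fun z => ENNReal.ofReal (jacobiWeight β γ z.2)))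

/-- The constant `b_{β,γ}` that normalizes the weight `w_{β,γ}` on the conic surface. -/
def coneConst (d : ℕ) (β γ : ℝ) : ℝ :=
  (1 / sphereArea d) *
    (Real.Gamma (β + γ + d + 1) / (Real.Gamma (β + d) * Real.Gamma (γ + 1)))

/-- The inner product `⟨f, g⟩_{β,γ} = b_{β,γ} ∫_V f g w_{β,γ} dm`. -/
def coneInner {d : ℕ} (β γ : ℝ) (f g : ConeFun d) : ℝ :=
  coneConst d β γ * ∫ z, f z * g z * jacobiWeight β γ z.2 ∂(coneMeasure d)

/-- The Sobolev inner product
`⟨f, g⟩_{β,-s} = ω_d⁻¹ ∫_V ∂_t^s f ∂_t^s g t^(β+s) dm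
  + ∑_{k < s} (λ_k / ω_d) ∫_{S^(d-1)} ∂_t^k f(ξ, 1) ∂_t^k g(ξ, 1) dσ(ξ)`. -/
def sobolevInner {d : ℕ} (s : ℕ) (β : ℝ) (lam : ℕ → ℝ) (f g : ConeFun d) : ℝ :=
  (1 / sphereArea d) *
      (∫ z, tDeriv s f z * tDeriv s g z * z.2 ^ (β + (s : ℝ)) ∂(coneMeasure d)) +
    ∑ k ∈ Finset.range s, (lam k / sphereArea d) *
      ∫ ξ : Metric.sphere (0 : EuclideanSpace ℝ (Fin d)) 1,
        tDeriv k f ((ξ : EuclideanSpace ℝ (Fin d)), 1) *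
          tDeriv k g ((ξ : EuclideanSpace ℝ (Fin d)), 1) ∂(sphereMeasure d)

/-- `p` is a solid harmonic of degree `m`: homogeneous of degree `m` with `Δ p = 0`. -/
def IsSolidHarmonic {d : ℕ} (m : ℕ) (p : MvPolynomial (Fin d) ℝ) : Prop :=
  p.IsHomogeneous m ∧ ∑ i, MvPolynomial.pderiv i (MvPolynomial.pderiv i p) = 0

/-- The polynomials of degree at most `n` on the conic surface, i.e. polynomials in `(x, t)`
modulo the ideal generated by `t² - ‖x‖²`. Each class has exactly one representative of the form
`∑ t^j Y(x)` with solid harmonics `Y` (replace `‖x‖²` by `t²`), and classes are identified with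
these representatives; it is on them that `∂_t` acts, namely on the powers of `t` only. -/
def conePoly (d n : ℕ) : Submodule ℝ (ConeFun d) :=
  Submodule.span ℝ {g | ∃ (j m : ℕ) (p : MvPolynomial (Fin d) ℝ), j + m ≤ n ∧
    IsSolidHarmonic m p ∧ g = fun z => z.2 ^ j * MvPolynomial.eval (fun i => z.1 i) p}

/-- The space of orthogonal polynomials of degree `n` for a bilinear form `B`: the polynomials
of degree at most `n` on the conic surface that are orthogonal to all those of lower degree. -/
def orthPoly {d : ℕ} (B : ConeFun d → ConeFun d → ℝ) (n : ℕ) : Set (ConeFun d) :=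
  {P | P ∈ conePoly d n ∧ ∀ k < n, ∀ q ∈ conePoly d k, B P q = 0}

/-- `P` is the orthogonal projection of `f` onto the space of orthogonal polynomials of
degree `n` for `B`. -/
def IsOrthProj {d : ℕ} (B : ConeFun d → ConeFun d → ℝ) (n : ℕ) (f P : ConeFun d) : Prop :=
  P ∈ orthPoly B n ∧ ∀ g ∈ orthPoly B n, B (f - P) g = 0

/-- `P = proj_n^{β,γ} f`. -/
def IsConeProj {d : ℕ} (β γ : ℝ) (n : ℕ) (f P : ConeFun d) : Prop :=
  IsOrthProj (coneInner β γ) n f P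

/-- `P = proj_n^{β,-s} f`. -/
def IsSobolevProj {d : ℕ} (s : ℕ) (β : ℝ) (lam : ℕ → ℝ) (n : ℕ) (f P : ConeFun d) : Prop :=
  IsOrthProj (sobolevInner s β lam) n f P

end

/-! On the spanning functions `t^j Y(x)` the operator `∂_t` acts on the power of `t` alone, so
`∂_t^s` maps degree `n` to degree `n - s`. It has a right inverse on polynomials: integrate `s`
times from `t = 1` (`exists_tDeriv_eq`). The resulting `G` satisfies `∂_t^k G(·, 1) = 0` for `k <
s`, so pairing with `G` kills the rim terms of the Sobolev form and leaves a constant multiple of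
the weighted form of the `s`-th derivatives (`coneInner_tDeriv_eq`). Hence `∂_t^s` maps
Sobolev-orthogonal polynomials to weighted-orthogonal ones (`tDeriv_mem_orthPoly`), and each of the
latter comes from a rim-flat one (`exists_mem_orthPoly_tDeriv_eq`). Testing `f - P` against these
shows that `∂_t^s P` is a projection of `∂_t^s f` (`isConeProj_tDeriv`); uniqueness identifies it
with `Q`.

Existence and uniqueness are finite-dimensional linear algebra once both forms are definite on
polynomials. The forms only see the cone, whereas the polynomials live on all of `ℝ^d × ℝ`.
Harmonicity closes this gap: a harmonic polynomial vanishing on one sphere centred at the origin is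
zero (`harmonic_eval_eq_zero_of_sphere`). -/

noncomputable section

/-! ### Orthogonal projection for a bilinear form definite on polynomials -/

/-- The form `B` is symmetric and bilinear on the subspace `A`. -/
structure IsSymmBilinOn {d : ℕ} (B : ConeFun d → ConeFun d → ℝ)
    (A : Submodule ℝ (ConeFun d)) : Prop where
  symm : ∀ f ∈ A, ∀ g ∈ A, B f g = B g f
  add_left : ∀ f ∈ A, ∀ g ∈ A, ∀ h ∈ A, B (f + g) h = B f h + B g h
  smul_left : ∀ c : ℝ, ∀ f ∈ A, ∀ h ∈ A, B (c • f) h = c * B f h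

namespace IsSymmBilinOn

variable {d : ℕ} {B : ConeFun d → ConeFun d → ℝ} {A : Submodule ℝ (ConeFun d)}

theorem add_right (hB : IsSymmBilinOn B A) {f g h : ConeFun d} (hf : f ∈ A) (hg : g ∈ A)
    (hh : h ∈ A) : B f (g + h) = B f g + B f h := by
  rw [hB.symm f hf _ (A.add_mem hg hh), hB.add_left g hg h hh f hf, hB.symm g hg f hf,
    hB.symm h hh f hf]

theorem smul_right (hB : IsSymmBilinOn B A) (c : ℝ) {f g : ConeFun d} (hf : f ∈ A) (hg : g ∈ A) :
    B f (c • g) = c * B f g := by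
  rw [hB.symm f hf _ (A.smul_mem c hg), hB.smul_left c g hg f hf, hB.symm g hg f hf]

theorem sub_left (hB : IsSymmBilinOn B A) {f g h : ConeFun d} (hf : f ∈ A) (hg : g ∈ A)
    (hh : h ∈ A) : B (f - g) h = B f h - B g h := by
  have := hB.add_left (f - g) (A.sub_mem hf hg) g hg h hh
  rw [sub_add_cancel] at this
  linarith

theorem zero_left (hB : IsSymmBilinOn B A) {h : ConeFun d} (hh : h ∈ A) : B 0 h = 0 := by
  simpa using hB.smul_left 0 0 A.zero_mem h hh

/-- The orthogonal polynomials of degree `n` as a subspace. -/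
def orthSubmodule (hB : IsSymmBilinOn B A) (hV : ∀ n, conePoly d n ≤ A) (n : ℕ) :
    Submodule ℝ (ConeFun d) where
  carrier := orthPoly B n
  add_mem' := fun {a b} ha hb => ⟨Submodule.add_mem _ ha.1 hb.1, fun k hk q hq => by
    rw [hB.add_left a (hV _ ha.1) b (hV _ hb.1) q (hV _ hq), ha.2 k hk q hq, hb.2 k hk q hq,
      add_zero]⟩
  zero_mem' := ⟨Submodule.zero_mem _, fun k _ q hq => hB.zero_left (hV _ hq)⟩
  smul_mem' := fun c a ha => ⟨Submodule.smul_mem _ c ha.1, fun k hk q hq => by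
    rw [hB.smul_left c a (hV _ ha.1) q (hV _ hq), ha.2 k hk q hq, mul_zero]⟩

/-- Definiteness makes the form nondegenerate on the finite-dimensional space of orthogonal
polynomials, so the functional `B f` is represented by exactly one element. The form need not be
definite on the larger space `A` containing `f`. -/
theorem existsUnique_isOrthProj (hB : IsSymmBilinOn B A) (hV : ∀ n, conePoly d n ≤ A) {n : ℕ}
    [FiniteDimensional ℝ (conePoly d n)]
    (hpos : ∀ P ∈ conePoly d n, B P P = 0 → P = 0) {f : ConeFun d} (hf : f ∈ A) :
    ∃! P, IsOrthProj B n f P := by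
  set U := hB.orthSubmodule hV n with hU
  have hUV : U ≤ conePoly d n := fun P hP => hP.1
  have hUA : U ≤ A := hUV.trans (hV n)
  have : FiniteDimensional ℝ U := Submodule.finiteDimensional_of_le hUV
  let φ : U →ₗ[ℝ] U →ₗ[ℝ] ℝ := LinearMap.mk₂ ℝ (fun P Q : U => B P Q)
    (fun P Q R => hB.add_left _ (hUA P.2) _ (hUA Q.2) _ (hUA R.2))
    (fun c P Q => hB.smul_left c _ (hUA P.2) _ (hUA Q.2))
    (fun P Q R => hB.add_right (hUA P.2) (hUA Q.2) (hUA R.2))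
    (fun c P Q => hB.smul_right c (hUA P.2) (hUA Q.2))
  let ψ : U →ₗ[ℝ] ℝ :=
    { toFun := fun Q => B f Q
      map_add' := fun P Q => hB.add_right hf (hUA P.2) (hUA Q.2)
      map_smul' := fun c P => hB.smul_right c hf (hUA P.2) }
  have hinj : Function.Injective φ := by
    rw [← LinearMap.ker_eq_bot, LinearMap.ker_eq_bot']
    intro P hP
    have h := LinearMap.congr_fun hP P
    exact Subtype.ext (hpos _ (hUV P.2) h)
  have hsurj : Function.Surjective φ :=
    (LinearMap.injective_iff_surjective_of_finrank_eq_finrank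
      (Subspace.dual_finrank_eq (K := ℝ) (V := U)).symm).1 hinj
  obtain ⟨P, hP⟩ := hsurj ψ
  refine ⟨P, ⟨P.2, fun g hg => ?_⟩, fun Q hQ => ?_⟩
  · have h : B P g = B f g := LinearMap.congr_fun hP ⟨g, hg⟩
    rw [hB.sub_left hf (hUA P.2) (hUA hg), h, sub_self]
  · have hφ : φ ⟨Q, hQ.1⟩ = ψ := LinearMap.ext fun g => by
      have h := hQ.2 g g.2
      rw [hB.sub_left hf (hUA hQ.1) (hUA g.2)] at h
      exact (sub_eq_zero.1 h).symm
    exact congrArg Subtype.val (hinj (hφ.trans hP.symm))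

end IsSymmBilinOn

/-! ### Harmonic polynomials and the maximum principle -/

open MvPolynomial in
theorem hasDerivAt_eval_update {d : ℕ} (p : MvPolynomial (Fin d) ℝ) (x : Fin d → ℝ) (i : Fin d)
    (τ : ℝ) : HasDerivAt (fun τ => eval (Function.update x i τ) p)
      (eval (Function.update x i τ) (pderiv i p)) τ := by
  induction p using MvPolynomial.induction_on with
  | C a => simpa using hasDerivAt_const τ a
  | add p q hp hq => simpa only [map_add] using hp.fun_add hq
  | mul_X p j hp =>
    have hX : HasDerivAt (fun τ => Function.update x i τ j)
        (eval (Function.update x i τ) (pderiv i (X j))) τ := by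
      rcases eq_or_ne j i with rfl | h
      · simpa using hasDerivAt_id' τ
      · simpa [h, pderiv_X_of_ne h] using hasDerivAt_const τ (x j)
    simpa [Derivation.leibniz, mul_comm, add_comm] using hp.fun_mul hX

/-- If the second derivative were positive, the point would also be a local minimum, so `g` would be
locally constant and its second derivative zero. -/
theorem deriv_deriv_nonpos_of_isLocalMax {g : ℝ → ℝ} {a : ℝ} (h : IsLocalMax g a)
    (hc : ContinuousAt g a) : deriv (deriv g) a ≤ 0 := by
  by_contra! hpos
  have hmin := isLocalMin_of_deriv_deriv_pos hpos h.deriv_eq_zero hc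
  have hconst : g =ᶠ[nhds a] fun _ => g a := by
    filter_upwards [h, hmin] with y h1 h2 using le_antisymm h1 h2
  have : deriv (deriv g) a = 0 := by
    rw [hconst.deriv.deriv_eq]; simp
  linarith

open MvPolynomial in
theorem continuous_eval_euclidean {d : ℕ} (p : MvPolynomial (Fin d) ℝ) :
    Continuous fun x : EuclideanSpace ℝ (Fin d) => eval (fun i => x i) p :=
  (MvPolynomial.continuous_eval p).comp (by fun_prop)

open MvPolynomial in
/-- The weak maximum principle for strictly subharmonic polynomials on a ball. -/
theorem exists_sphere_eval_ge {d : ℕ} {q : MvPolynomial (Fin d) ℝ}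
    (hq : ∀ x : Fin d → ℝ, 0 < eval x (∑ i, pderiv i (pderiv i q))) {r : ℝ}
    {x : EuclideanSpace ℝ (Fin d)} (hx : ‖x‖ ≤ r) :
    ∃ y : EuclideanSpace ℝ (Fin d), ‖y‖ = r ∧
      eval (fun i => x i) q ≤ eval (fun i => y i) q := by
  obtain ⟨y, hy, hmax⟩ := (isCompact_closedBall (0 : EuclideanSpace ℝ (Fin d)) r).exists_isMaxOn
    ⟨x, by simpa using hx⟩ (continuous_eval_euclidean q).continuousOn
  have hyr : ‖y‖ ≤ r := by simpa using hy
  refine ⟨y, hyr.antisymm (not_lt.1 fun hlt => ?_), hmax (by simpa using hx)⟩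
  have hloc : IsLocalMax (fun x : EuclideanSpace ℝ (Fin d) => eval (fun i => x i) q) y :=
    hmax.isLocalMax (Filter.mem_of_superset (Metric.isOpen_ball.mem_nhds
      (by simpa using hlt : y ∈ Metric.ball (0 : EuclideanSpace ℝ (Fin d)) r))
      Metric.ball_subset_closedBall)
  -- At an interior maximum every pure second partial is nonpositive, which contradicts the positive
  -- Laplacian.
  refine (hq fun i => y i).not_ge ?_
  rw [map_sum]
  refine Finset.sum_nonpos fun i _ => ?_
  set g : ℝ → ℝ := fun τ => eval (Function.update (fun i => y i) i τ) q with hg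
  have h1 : deriv g = fun τ => eval (Function.update (fun i => y i) i τ) (pderiv i q) :=
    funext fun τ => (hasDerivAt_eval_update q _ i τ).deriv
  have h2 : deriv (deriv g) (y i) = eval (fun i => y i) (pderiv i (pderiv i q)) := by
    rw [h1, (hasDerivAt_eval_update (pderiv i q) _ i (y i)).deriv, Function.update_eq_self]
  rw [← h2]
  refine deriv_deriv_nonpos_of_isLocalMax ?_ (hasDerivAt_eval_update q _ i _).continuousAt
  have hcont : Continuous fun τ : ℝ =>
      (WithLp.toLp 2 (Function.update (fun i => y i) i τ) : EuclideanSpace ℝ (Fin d)) :=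
    (PiLp.continuous_toLp 2 _).comp (continuous_const.update i continuous_id)
  have hy' : (WithLp.toLp 2 (Function.update (fun i => y i) i (y i)) :
      EuclideanSpace ℝ (Fin d)) = y := by
    rw [Function.update_eq_self]
  exact IsLocalMax.comp_continuous (g := fun τ : ℝ =>
      (WithLp.toLp 2 (Function.update (fun i => y i) i τ) : EuclideanSpace ℝ (Fin d)))
    (by rwa [hy']) hcont.continuousAt

-- Adding `ε‖x‖²` raises the Laplacian to `2dε > 0`, so the strict maximum principle applies; then
-- `ε` is made small.
open MvPolynomial in
theorem harmonic_eval_nonpos_of_sphere {d : ℕ} [NeZero d] {p : MvPolynomial (Fin d) ℝ}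
    (hp : ∑ i, pderiv i (pderiv i p) = 0) {r : ℝ}
    (h : ∀ y : EuclideanSpace ℝ (Fin d), ‖y‖ = r → eval (fun i => y i) p = 0)
    {x : EuclideanSpace ℝ (Fin d)} (hx : ‖x‖ ≤ r) : eval (fun i => x i) p ≤ 0 := by
  have key : ∀ ε : ℝ, 0 < ε → eval (fun i => x i) p ≤ ε * r ^ 2 := by
    intro ε hε
    have hpd : ∀ i : Fin d, pderiv i (pderiv i (∑ j : Fin d, (X j : MvPolynomial (Fin d) ℝ) ^ 2))
        = C 2 := by
      intro i
      have : pderiv i (∑ j : Fin d, (X j : MvPolynomial (Fin d) ℝ) ^ 2) = C 2 * X i := by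
        rw [map_sum, Finset.sum_eq_single i]
        · simp [Derivation.leibniz_pow]
          exact (map_ofNat C 2).symm
        · intro j _ hj
          simp [Derivation.leibniz_pow, pderiv_X_of_ne hj]
        · simp
      rw [this, pderiv_C_mul, pderiv_X_self, mul_one]
    have hev : ∀ z : EuclideanSpace ℝ (Fin d),
        eval (fun i => z i) (p + C ε * ∑ j : Fin d, (X j) ^ 2)
          = eval (fun i => z i) p + ε * ‖z‖ ^ 2 := by
      intro z
      simp [EuclideanSpace.real_norm_sq_eq]
    obtain ⟨y, hy, hle⟩ := exists_sphere_eval_ge (q := p + C ε * ∑ j : Fin d, (X j) ^ 2)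
      (fun z => by
        have : ∑ i, pderiv i (pderiv i (p + C ε * ∑ j : Fin d, (X j) ^ 2))
            = C (d * (ε * 2)) := by
          simp only [map_add, pderiv_C_mul, Finset.sum_add_distrib, hp, hpd]
          simp
        rw [this, eval_C]
        have : 0 < (d : ℝ) := Nat.cast_pos.2 (NeZero.pos d)
        positivity) hx
    rw [hev, hev, h y hy, hy] at hle
    nlinarith [sq_nonneg ‖x‖]
  by_contra! hpos
  -- With this `ε` the bound `ε r²` is less than half of the supposedly positive value.
  have h1 := key (eval (fun i => x i) p / (2 * (r ^ 2 + 1))) (by positivity)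
  have h2 : eval (fun i => x i) p / (2 * (r ^ 2 + 1)) * r ^ 2 < eval (fun i => x i) p := by
    rw [div_mul_eq_mul_div, div_lt_iff₀ (by positivity)]
    nlinarith [sq_nonneg r]
  linarith

-- The maximum principle for `p` and `-p` gives vanishing on the ball. Along the ray through `x`,
-- `p` is a one-variable polynomial with infinitely many zeros, hence zero, also at parameter `1`.
open MvPolynomial in
theorem harmonic_eval_eq_zero_of_sphere {d : ℕ} [NeZero d] {p : MvPolynomial (Fin d) ℝ}
    (hp : ∑ i, pderiv i (pderiv i p) = 0) {r : ℝ} (hr : 0 < r)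
    (h : ∀ y : EuclideanSpace ℝ (Fin d), ‖y‖ = r → eval (fun i => y i) p = 0)
    (x : EuclideanSpace ℝ (Fin d)) : eval (fun i => x i) p = 0 := by
  have hball : ∀ z : EuclideanSpace ℝ (Fin d), ‖z‖ ≤ r → eval (fun i => z i) p = 0 := by
    intro z hz
    refine le_antisymm (harmonic_eval_nonpos_of_sphere hp h hz) ?_
    have := harmonic_eval_nonpos_of_sphere (p := -p) (by simp [hp]) (r := r)
      (fun y hy => by simp [h y hy]) hz
    simpa using this
  have hev : ∀ (q : MvPolynomial (Fin d) ℝ) (τ : ℝ),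
      (aeval (fun i => Polynomial.X * Polynomial.C (x i)) q : Polynomial ℝ).eval τ
        = eval (fun i => (τ • x) i) q := by
    intro q τ
    induction q using MvPolynomial.induction_on with
    | C a => simp
    | add q₁ q₂ h₁ h₂ => simp only [map_add, Polynomial.eval_add, h₁, h₂]
    | mul_X q j hq =>
      simp only [map_mul, Polynomial.eval_mul, hq, aeval_X, eval_X]
      simp
  set P : Polynomial ℝ := aeval (fun i => Polynomial.X * Polynomial.C (x i)) p
  have hP := hev p
  have hP0 : P = 0 := by
    refine Polynomial.eq_of_infinite_eval_eq _ _ ((Set.Ioo_infinite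
      (show (0 : ℝ) < r / (‖x‖ + 1) by positivity)).mono fun τ hτ => ?_)
    have : ‖τ • x‖ ≤ r := by
      rw [norm_smul, Real.norm_of_nonneg hτ.1.le]
      have := (lt_div_iff₀ (by positivity)).1 hτ.2
      nlinarith [hτ.1, norm_nonneg x]
    simp only [Set.mem_ofPred_eq, P, hP, hball _ this, Polynomial.eval_zero]
  have h1 : P.eval 1 = _ := hP 1
  simpa [hP0] using h1.symm

/-! ### Polynomials on the cone and their slices -/

theorem mem_conePoly_of_le {d n j m : ℕ} {p : MvPolynomial (Fin d) ℝ} (hp : IsSolidHarmonic m p)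
    (h : j + m ≤ n) :
    (fun z => z.2 ^ j * MvPolynomial.eval (fun i => z.1 i) p : ConeFun d) ∈ conePoly d n :=
  Submodule.subset_span ⟨j, m, p, h, hp, rfl⟩

instance finiteDimensional_conePoly (d n : ℕ) : FiniteDimensional ℝ (conePoly d n) := by
  let V := MvPolynomial.restrictTotalDegree (Fin d) ℝ n
  let e : ℕ → MvPolynomial (Fin d) ℝ →ₗ[ℝ] ConeFun d := fun j =>
    { toFun := fun p z => z.2 ^ j * MvPolynomial.eval (fun i => z.1 i) p
      map_add' := fun p q => by ext z; simp [mul_add]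
      map_smul' := fun c p => by ext z; simp [mul_left_comm] }
  have hle : conePoly d n ≤ ⨆ j : Fin (n + 1), V.map (e j) := by
    refine Submodule.span_le.2 ?_
    rintro g ⟨j, m, p, hjm, hp, rfl⟩
    refine Submodule.mem_iSup_of_mem (⟨j, by omega⟩ : Fin (n + 1)) ⟨p, ?_, rfl⟩
    exact (MvPolynomial.mem_restrictTotalDegree _ _ _).2 (hp.1.totalDegree_le.trans (by omega))
  exact Submodule.finiteDimensional_of_le hle

theorem continuous_of_mem_conePoly {d n : ℕ} {P : ConeFun d} (hP : P ∈ conePoly d n) :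
    Continuous P := by
  induction hP using Submodule.span_induction with
  | mem g hg =>
    obtain ⟨j, m, p, -, -, rfl⟩ := hg
    exact (continuous_snd.pow j).mul ((continuous_eval_euclidean p).comp continuous_fst)
  | zero => exact continuous_const
  | add f g _ _ hf hg => exact hf.add hg
  | smul c f _ hf => exact hf.const_smul c

theorem exists_polynomial_of_mem_conePoly {d n : ℕ} {P : ConeFun d} (hP : P ∈ conePoly d n)
    (x : EuclideanSpace ℝ (Fin d)) : ∃ q : Polynomial ℝ, ∀ t, P (x, t) = q.eval t := by
  induction hP using Submodule.span_induction with
  | mem g hg =>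
    obtain ⟨j, m, p, -, -, rfl⟩ := hg
    exact ⟨Polynomial.X ^ j * Polynomial.C (MvPolynomial.eval (fun i => x i) p),
      fun t => by
        rw [Polynomial.eval_mul, Polynomial.eval_pow, Polynomial.eval_X, Polynomial.eval_C]⟩
  | zero => exact ⟨0, by simp⟩
  | add f g _ _ hf hg =>
    obtain ⟨a, ha⟩ := hf
    obtain ⟨b, hb⟩ := hg
    exact ⟨a + b, by simp [ha, hb]⟩
  | smul c f _ hf =>
    obtain ⟨a, ha⟩ := hf
    exact ⟨c • a, by simp [ha]⟩

open MvPolynomial in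
theorem exists_harmonic_of_mem_conePoly {d n : ℕ} {P : ConeFun d} (hP : P ∈ conePoly d n)
    (t : ℝ) : ∃ q : MvPolynomial (Fin d) ℝ, ∑ i, pderiv i (pderiv i q) = 0 ∧
      ∀ x, P (x, t) = eval (fun i => x i) q := by
  induction hP using Submodule.span_induction with
  | mem g hg =>
    obtain ⟨j, m, p, -, hp, rfl⟩ := hg
    exact ⟨C (t ^ j) * p, by simp only [pderiv_C_mul, ← Finset.mul_sum, hp.2, mul_zero], by simp⟩
  | zero => exact ⟨0, by simp⟩
  | add f g _ _ hf hg =>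
    obtain ⟨a, ha0, ha⟩ := hf
    obtain ⟨b, hb0, hb⟩ := hg
    exact ⟨a + b, by simp [Finset.sum_add_distrib, ha0, hb0], by simp [ha, hb]⟩
  | smul c f _ hf =>
    obtain ⟨a, ha0, ha⟩ := hf
    exact ⟨C c * a, by simp only [pderiv_C_mul, ← Finset.mul_sum, ha0, mul_zero], by simp [ha]⟩

/-- A polynomial on the cone whose trace at height `t` vanishes on a sphere vanishes at height
`t`. -/
theorem conePoly_eq_zero_of_sphere {d n : ℕ} [NeZero d] {P : ConeFun d} (hP : P ∈ conePoly d n)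
    {r t : ℝ} (hr : 0 < r) (h : ∀ x : EuclideanSpace ℝ (Fin d), ‖x‖ = r → P (x, t) = 0)
    (x : EuclideanSpace ℝ (Fin d)) : P (x, t) = 0 := by
  obtain ⟨q, hq, hqe⟩ := exists_harmonic_of_mem_conePoly hP t
  rw [hqe]
  exact harmonic_eval_eq_zero_of_sphere hq hr (fun y hy => by rw [← hqe, h y hy]) x

theorem contDiff_slice_of_mem_conePoly {d n : ℕ} {P : ConeFun d} (hP : P ∈ conePoly d n)
    (x : EuclideanSpace ℝ (Fin d)) (k : WithTop ℕ∞) : ContDiff ℝ k fun v : ℝ => P (x, v) := by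
  obtain ⟨q, hq⟩ := exists_polynomial_of_mem_conePoly hP x
  simpa only [hq, Polynomial.coe_aeval_eq_eval] using q.contDiff_aeval (𝕜 := ℝ) k

/-! ### The action of `∂_t` on polynomials -/

theorem tDeriv_zero_left {d : ℕ} (f : ConeFun d) : tDeriv 0 f = f := by
  ext z; simp [tDeriv]

theorem tDeriv_zero_right {d : ℕ} (k : ℕ) : tDeriv k (0 : ConeFun d) = 0 := by
  ext z
  simp [tDeriv]

theorem tDeriv_smul {d : ℕ} (k : ℕ) (c : ℝ) (f : ConeFun d) :
    tDeriv k (c • f) = c • tDeriv k f := by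
  ext z
  exact iteratedDeriv_const_smul_field c _

theorem tDeriv_add_of_mem_conePoly {d m n : ℕ} (k : ℕ) {f g : ConeFun d} (hf : f ∈ conePoly d m)
    (hg : g ∈ conePoly d n) : tDeriv k (f + g) = tDeriv k f + tDeriv k g := by
  ext z
  exact iteratedDeriv_add (contDiff_slice_of_mem_conePoly hf z.1 _).contDiffAt
    (contDiff_slice_of_mem_conePoly hg z.1 _).contDiffAt

theorem tDeriv_comp_one {d : ℕ} (k : ℕ) (f : ConeFun d) :
    tDeriv k (tDeriv 1 f) = tDeriv (k + 1) f := by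
  ext z
  simp [tDeriv, iteratedDeriv_succ']

theorem tDeriv_one_comp {d : ℕ} (k : ℕ) (f : ConeFun d) :
    tDeriv 1 (tDeriv k f) = tDeriv (k + 1) f := by
  ext z
  simp [tDeriv, iteratedDeriv_succ]

/-- The truncated exponent `j - k` is harmless: for `k > j` the falling factorial vanishes. -/
theorem tDeriv_pow_mul {d : ℕ} (k j : ℕ) (Y : EuclideanSpace ℝ (Fin d) → ℝ) :
    tDeriv k (fun z => z.2 ^ j * Y z.1) =
      (j.descFactorial k : ℝ) • fun z => z.2 ^ (j - k) * Y z.1 := by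
  ext z
  simp only [tDeriv, Pi.smul_apply, smul_eq_mul]
  have h := iteratedDeriv_const_mul_field (n := k) (x := z.2) (Y z.1) (fun v : ℝ => v ^ j)
  simp only [mul_comm (Y z.1)] at h
  rw [h, iteratedDeriv_pow]
  ring

theorem tDeriv_mem_conePoly {d n : ℕ} {P : ConeFun d} (hP : P ∈ conePoly d n) (k : ℕ) :
    tDeriv k P ∈ conePoly d (n - k) := by
  induction hP using Submodule.span_induction with
  | mem g hg =>
    obtain ⟨j, m, p, hjm, hp, rfl⟩ := hg
    rw [tDeriv_pow_mul k j fun x => MvPolynomial.eval (fun i => x i) p]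
    rcases lt_or_ge j k with h | h
    · simp [Nat.descFactorial_eq_zero_iff_lt.2 h]
    · exact Submodule.smul_mem _ _ (mem_conePoly_of_le hp (by omega))
  | zero => rw [tDeriv_zero_right]; exact Submodule.zero_mem _
  | add f g hf' hg' hf hg =>
    rw [tDeriv_add_of_mem_conePoly k hf' hg']
    exact Submodule.add_mem _ hf hg
  | smul c f _ hf => rw [tDeriv_smul]; exact Submodule.smul_mem _ _ hf

theorem tDeriv_eq_zero_of_lt {d n k : ℕ} {P : ConeFun d} (hP : P ∈ conePoly d n) (hk : n < k) :
    tDeriv k P = 0 := by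
  induction hP using Submodule.span_induction with
  | mem g hg =>
    obtain ⟨j, m, p, hjm, hp, rfl⟩ := hg
    rw [tDeriv_pow_mul k j fun x => MvPolynomial.eval (fun i => x i) p,
      Nat.descFactorial_eq_zero_iff_lt.2 (by omega)]
    simp
  | zero => exact tDeriv_zero_right k
  | add f g hf' hg' hf hg => rw [tDeriv_add_of_mem_conePoly k hf' hg', hf, hg, add_zero]
  | smul c f _ hf => rw [tDeriv_smul, hf, smul_zero]

/-- For `t^j Y` take `(t^(j+1) - 1) Y / (j+1)`; the subtracted term is again a multiple of a
spanning function, `t^0 Y`. -/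
theorem exists_tDeriv_one_eq {d n : ℕ} {Q : ConeFun d} (hQ : Q ∈ conePoly d n) :
    ∃ G ∈ conePoly d (n + 1), tDeriv 1 G = Q ∧ ∀ x, G (x, 1) = 0 := by
  induction hQ using Submodule.span_induction with
  | mem g hg =>
    obtain ⟨j, m, p, hjm, hp, rfl⟩ := hg
    have h1 := mem_conePoly_of_le hp (show j + 1 + m ≤ n + 1 by omega)
    have h0 := mem_conePoly_of_le hp (show 0 + m ≤ n + 1 by omega)
    have hj : (j : ℝ) + 1 ≠ 0 := by positivity
    refine ⟨_, Submodule.smul_mem _ ((j + 1 : ℝ)⁻¹)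
      (Submodule.add_mem _ h1 (Submodule.smul_mem _ (-1) h0)), ?_, fun x => by simp⟩
    rw [tDeriv_smul, tDeriv_add_of_mem_conePoly 1 h1 (Submodule.smul_mem _ (-1) h0), tDeriv_smul,
      tDeriv_pow_mul 1 (j + 1) fun x => MvPolynomial.eval (fun i => x i) p,
      tDeriv_pow_mul 1 0 fun x => MvPolynomial.eval (fun i => x i) p]
    ext z
    simp
    field_simp
  | zero => exact ⟨0, Submodule.zero_mem _, tDeriv_zero_right 1, by simp⟩
  | add f g _ _ hf hg =>
    obtain ⟨a, ha, haf, ha0⟩ := hf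
    obtain ⟨b, hb, hbg, hb0⟩ := hg
    exact ⟨a + b, Submodule.add_mem _ ha hb, by rw [tDeriv_add_of_mem_conePoly 1 ha hb, haf, hbg],
      by simp [ha0, hb0]⟩
  | smul c f _ hf =>
    obtain ⟨a, ha, haf, ha0⟩ := hf
    exact ⟨c • a, Submodule.smul_mem _ c ha, by rw [tDeriv_smul, haf], by simp [ha0]⟩

/-- Every polynomial on the cone is the `s`-th `t`-derivative of one whose first `s` derivatives
vanish on the rim. -/
theorem exists_tDeriv_eq {d n : ℕ} (s : ℕ) {Q : ConeFun d} (hQ : Q ∈ conePoly d n) :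
    ∃ G ∈ conePoly d (n + s), tDeriv s G = Q ∧ ∀ k < s, ∀ x, tDeriv k G (x, 1) = 0 := by
  induction s with
  | zero => exact ⟨Q, hQ, tDeriv_zero_left Q, by simp⟩
  | succ s ih =>
    obtain ⟨G, hG, hGQ, hG0⟩ := ih
    obtain ⟨H, hH, hHG, hH0⟩ := exists_tDeriv_one_eq hG
    refine ⟨H, hH, by rw [← tDeriv_comp_one, hHG, hGQ], fun k hk x => ?_⟩
    cases k with
    | zero => rw [tDeriv_zero_left, hH0]
    | succ k => rw [← tDeriv_comp_one, hHG, hG0 k (by omega)]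

/-- Each vanishing derivative makes the previous one constant in `t`, and its value at `t = 1` is
zero. This needs the data at `t = 1` for every `x`, not only on the unit sphere. -/
theorem eq_zero_of_tDeriv_eq_zero {d n s : ℕ} {P : ConeFun d} (hP : P ∈ conePoly d n)
    (hs : tDeriv s P = 0) (h1 : ∀ k < s, ∀ x, tDeriv k P (x, 1) = 0) : P = 0 := by
  induction s with
  | zero => rwa [tDeriv_zero_left] at hs
  | succ s ih =>
    refine ih ?_ fun k hk => h1 k (by omega)
    ext ⟨x, t⟩
    have hdiff : Differentiable ℝ fun v : ℝ => tDeriv s P (x, v) :=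
      (contDiff_slice_of_mem_conePoly (tDeriv_mem_conePoly hP s) x 1).differentiable one_ne_zero
    have hderiv : ∀ v, deriv (fun v : ℝ => tDeriv s P (x, v)) v = 0 := fun v => by
      have := congrFun (tDeriv_one_comp s P) (x, v)
      rw [hs] at this
      simpa [tDeriv] using this
    have := is_const_of_deriv_eq_zero hdiff hderiv t 1
    simpa [h1 s (by omega) x] using this

/-! ### The weighted measure on the cone and definiteness of its `L²` form -/

instance isOpenPosMeasure_sphereMeasure (d : ℕ) : (sphereMeasure d).IsOpenPosMeasure :=
  inferInstanceAs (Measure.toSphere _).IsOpenPosMeasure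

instance isFiniteMeasure_sphereMeasure (d : ℕ) : IsFiniteMeasure (sphereMeasure d) :=
  inferInstanceAs (IsFiniteMeasure (Measure.toSphere _))

theorem sphereArea_pos (d : ℕ) [NeZero d] : 0 < sphereArea d := by
  have h : sphereMeasure d ≠ 0 := Measure.toSphere_ne_zero _
  have : NeZero (sphereMeasure d) := ⟨h⟩
  exact measureReal_univ_pos

theorem jacobiWeight_zero_right (α t : ℝ) : jacobiWeight α 0 t = t ^ α := by
  simp [jacobiWeight]

theorem measurable_cone_map (d : ℕ) : Measurable
    fun p : ℝ × Metric.sphere (0 : EuclideanSpace ℝ (Fin d)) 1 =>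
      (p.1 • (p.2 : EuclideanSpace ℝ (Fin d)), p.1) :=
  Continuous.measurable (by fun_prop)

/-- The apex is null, so neither the value of `t ^ α` at `0` nor the behaviour of `f` there matters.
-/
theorem ae_mem_cone (d : ℕ) :
    ∀ᵐ z ∂coneMeasure d, ‖z.1‖ = z.2 ∧ 0 < z.2 ∧ z.2 ≤ 1 := by
  have hm : MeasurableSet
      {z : EuclideanSpace ℝ (Fin d) × ℝ | ‖z.1‖ = z.2 ∧ 0 < z.2 ∧ z.2 ≤ 1} :=
    (measurableSet_eq_fun measurable_fst.norm measurable_snd).inter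
      ((measurableSet_lt measurable_const measurable_snd).inter
        (measurableSet_le measurable_snd measurable_const))
  refine (ae_map_iff (measurable_cone_map d).aemeasurable hm).2 ?_
  have h : ∀ᵐ t ∂((volume : Measure ℝ).restrict (Set.Ioc 0 1)).withDensity
      (fun t => ENNReal.ofReal (t ^ (d - 1))), t ∈ Set.Ioc (0 : ℝ) 1 :=
    (withDensity_absolutelyContinuous _ _).ae_le (ae_restrict_mem measurableSet_Ioc)
  filter_upwards [Measure.quasiMeasurePreserving_fst.ae h] with p hp
  exact ⟨by rw [norm_smul, norm_eq_of_mem_sphere, mul_one, Real.norm_of_nonneg hp.1.le], hp⟩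

/-- The measure on the conic surface with the weight `t ^ α`. -/
def weightedConeMeasure (d : ℕ) (α : ℝ) : Measure (EuclideanSpace ℝ (Fin d) × ℝ) :=
  (coneMeasure d).withDensity fun z => ENNReal.ofReal (jacobiWeight α 0 z.2)

theorem measurable_weight (d : ℕ) (α : ℝ) : Measurable
    fun z : EuclideanSpace ℝ (Fin d) × ℝ => ENNReal.ofReal (jacobiWeight α 0 z.2) := by
  simp only [jacobiWeight_zero_right]
  exact (measurable_snd.pow_const α).ennreal_ofReal

theorem ae_mem_cone_weighted (d : ℕ) (α : ℝ) :
    ∀ᵐ z ∂weightedConeMeasure d α, ‖z.1‖ = z.2 ∧ 0 < z.2 ∧ z.2 ≤ 1 :=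
  (withDensity_absolutelyContinuous _ _).ae_le (ae_mem_cone d)

theorem integral_mul_rpow_coneMeasure {d : ℕ} (α : ℝ) (g : ConeFun d) :
    ∫ z, g z * z.2 ^ α ∂coneMeasure d = ∫ z, g z ∂weightedConeMeasure d α := by
  rw [weightedConeMeasure, integral_withDensity_eq_integral_toReal_smul (measurable_weight d α)
    (by simp)]
  refine integral_congr_ae ?_
  filter_upwards [ae_mem_cone d] with z hz
  simp only [jacobiWeight_zero_right]
  rw [ENNReal.toReal_ofReal (Real.rpow_nonneg hz.2.1.le α), smul_eq_mul, mul_comm]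

theorem isFiniteMeasure_weightedConeMeasure {d : ℕ} [NeZero d] {α : ℝ} (hα : -(d : ℝ) < α) :
    IsFiniteMeasure (weightedConeMeasure d α) := by
  constructor
  rw [weightedConeMeasure, withDensity_apply _ MeasurableSet.univ, Measure.restrict_univ,
    coneMeasure, lintegral_map (measurable_weight d α) (measurable_cone_map d)]
  simp only [jacobiWeight_zero_right]
  have hmeas : Measurable fun t : ℝ => ENNReal.ofReal (t ^ α) :=
    (measurable_id.pow_const α).ennreal_ofReal
  have h := lintegral_prod_mul (μ := ((volume : Measure ℝ).restrict (Set.Ioc 0 1)).withDensity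
      (fun t => ENNReal.ofReal (t ^ (d - 1)))) (ν := sphereMeasure d) hmeas.aemeasurable
      (aemeasurable_const (b := 1))
  simp only [mul_one, lintegral_const, one_mul] at h
  rw [h]
  refine ENNReal.mul_lt_top ?_ (measure_lt_top _ _)
  rw [lintegral_withDensity_eq_lintegral_mul _ (by fun_prop) hmeas]
  -- The density `t^(d-1)` shifts the exponent, and `α > -d` is exactly integrability at `0`.
  have hint : IntegrableOn (fun t : ℝ => t ^ (α + (d - 1 : ℝ))) (Set.Ioc 0 1) :=
    (intervalIntegrable_iff_integrableOn_Ioc_of_le zero_le_one).1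
      (intervalIntegral.intervalIntegrable_rpow' (by linarith))
  refine lt_of_eq_of_lt (setLIntegral_congr_fun measurableSet_Ioc fun t ht => ?_)
    hint.setLIntegral_lt_top
  have hd : ((d - 1 : ℕ) : ℝ) = d - 1 := by
    rw [Nat.cast_sub (NeZero.one_le), Nat.cast_one]
  simp only [Pi.mul_apply]
  rw [← ENNReal.ofReal_mul (pow_nonneg ht.1.le _), Real.rpow_add ht.1, ← hd, Real.rpow_natCast,
    mul_comm]

theorem memLp_of_mem_conePoly {d n : ℕ} [NeZero d] {α : ℝ} (hα : -(d : ℝ) < α) {P : ConeFun d}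
    (hP : P ∈ conePoly d n) : MemLp P 2 (weightedConeMeasure d α) := by
  have := isFiniteMeasure_weightedConeMeasure hα
  have hc := continuous_of_mem_conePoly hP
  obtain ⟨C, hC⟩ := ((isCompact_closedBall (0 : EuclideanSpace ℝ (Fin d)) 1).prod
    (isCompact_Icc (a := (0 : ℝ)) (b := 1))).exists_bound_of_continuousOn hc.continuousOn
  refine MemLp.of_bound hc.aestronglyMeasurable C ?_
  filter_upwards [ae_mem_cone_weighted d α] with z hz
  exact hC z ⟨by simpa [hz.1] using hz.2.2, hz.2.1.le, hz.2.2⟩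

/-- By Fubini and continuity, `P(·, t)` vanishes on the sphere of radius `t` for almost every `t` in
`(0, 1]`, hence for all `x` by harmonicity. For fixed `x` this gives infinitely many zeros of a
polynomial in `t`. -/
theorem eq_zero_of_ae_coneMeasure_eq_zero {d n : ℕ} [NeZero d] {P : ConeFun d}
    (hP : P ∈ conePoly d n) (h : ∀ᵐ z ∂coneMeasure d, P z = 0) : P = 0 := by
  have h1 := Measure.ae_ae_of_ae_prod (ae_of_ae_map (measurable_cone_map d).aemeasurable h)
  rw [ae_withDensity_iff (by fun_prop)] at h1
  have h2 : ∀ᵐ t ∂(volume : Measure ℝ).restrict (Set.Ioc 0 1),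
      ∀ x : EuclideanSpace ℝ (Fin d), P (x, t) = 0 := by
    filter_upwards [h1, ae_restrict_mem measurableSet_Ioc] with t ht htm
    have hae := ht (by simpa using pow_pos htm.1 _)
    have hcont : Continuous fun ξ : Metric.sphere (0 : EuclideanSpace ℝ (Fin d)) 1 =>
        P (t • (ξ : EuclideanSpace ℝ (Fin d)), t) :=
      (continuous_of_mem_conePoly hP).comp (by fun_prop)
    have hzero := (hcont.ae_eq_iff_eq (sphereMeasure d) continuous_const).1 hae
    refine conePoly_eq_zero_of_sphere hP htm.1 fun x hx => ?_
    have hx' : t⁻¹ • x ∈ Metric.sphere (0 : EuclideanSpace ℝ (Fin d)) 1 := by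
      simp [norm_smul, hx, abs_of_pos htm.1, htm.1.ne']
    have := congrFun hzero ⟨t⁻¹ • x, hx'⟩
    simpa [smul_smul, htm.1.ne'] using this
  have hinf : {t : ℝ | ∀ x : EuclideanSpace ℝ (Fin d), P (x, t) = 0}.Infinite := fun hfin => by
    have hne : (ae ((volume : Measure ℝ).restrict (Set.Ioc 0 1))).NeBot := by
      rw [ae_restrict_neBot]; simp
    obtain ⟨t, ht, ht'⟩ := (h2.and (hfin.countable.ae_notMem _)).exists
    exact ht' ht
  ext ⟨x, t⟩
  obtain ⟨q, hq⟩ := exists_polynomial_of_mem_conePoly hP x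
  have hq0 : q = 0 := Polynomial.eq_of_infinite_eval_eq _ _ (hinf.mono fun t ht => by
    simpa [hq] using ht x)
  rw [hq, hq0]
  simp

theorem eq_zero_of_integral_sq_eq_zero {d n : ℕ} [NeZero d] {α : ℝ} (hα : -(d : ℝ) < α)
    {P : ConeFun d} (hP : P ∈ conePoly d n)
    (h : ∫ z, P z * P z ∂weightedConeMeasure d α = 0) : P = 0 := by
  have hL := memLp_of_mem_conePoly hα hP
  have h0 := (integral_eq_zero_iff_of_nonneg (fun z => mul_self_nonneg (P z))
    (hL.integrable_mul hL)).1 h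
  refine eq_zero_of_ae_coneMeasure_eq_zero hP ?_
  have h1 := (ae_withDensity_iff (measurable_weight d α)).1 h0
  filter_upwards [h1, ae_mem_cone d] with z hz hzm
  refine mul_self_eq_zero.1 (hz ?_)
  rw [jacobiWeight_zero_right]
  simpa using Real.rpow_pos_of_pos hzm.2.1 α

/-! ### The weighted form and its projections -/

theorem coneInner_eq {d : ℕ} (α : ℝ) (f g : ConeFun d) : coneInner α 0 f g =
    coneConst d α 0 * ∫ z, f z * g z ∂weightedConeMeasure d α := by
  simp only [coneInner, jacobiWeight_zero_right, integral_mul_rpow_coneMeasure]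

theorem coneConst_pos {d : ℕ} [NeZero d] {α : ℝ} (hα : -(d : ℝ) < α) : 0 < coneConst d α 0 := by
  have h1 := Real.Gamma_pos_of_pos (show 0 < α + 0 + d + 1 by linarith)
  have h2 := Real.Gamma_pos_of_pos (show 0 < α + d by linarith)
  have h3 := Real.Gamma_pos_of_pos (show (0 : ℝ) < 0 + 1 by norm_num)
  have h4 := sphereArea_pos d
  unfold coneConst
  positivity

/-- The functions in `L²` of the conic surface with the weight `t ^ α`. -/
def coneL2 (d : ℕ) (α : ℝ) : Submodule ℝ (ConeFun d) where
  carrier := {f | MemLp f 2 (weightedConeMeasure d α)}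
  add_mem' := fun hf hg => MemLp.add hf hg
  zero_mem' := MemLp.zero
  smul_mem' := fun c _ hf => MemLp.const_smul hf c

theorem isSymmBilinOn_coneInner (d : ℕ) (α : ℝ) :
    IsSymmBilinOn (coneInner α 0) (coneL2 d α) where
  symm := fun f _ g _ => by simp only [coneInner_eq, mul_comm]
  add_left := fun f hf g hg h hh => by
    have := integral_add (MemLp.integrable_mul hf hh) (MemLp.integrable_mul hg hh)
    simp only [Pi.mul_apply] at this
    simp only [coneInner_eq, Pi.add_apply, add_mul, this, mul_add]
  smul_left := fun c f _ h _ => by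
    simp only [coneInner_eq, Pi.smul_apply, smul_eq_mul, mul_assoc, integral_const_mul]
    ring

theorem conePoly_le_coneL2 {d : ℕ} [NeZero d] {α : ℝ} (hα : -(d : ℝ) < α) (n : ℕ) :
    conePoly d n ≤ coneL2 d α := fun _ hP => memLp_of_mem_conePoly hα hP

theorem existsUnique_isConeProj {d : ℕ} [NeZero d] {α : ℝ} (hα : -(d : ℝ) < α) (n : ℕ)
    {f : ConeFun d} (hf : MemL2Cone α 0 f) : ∃! P, IsConeProj α 0 n f P := by
  refine (isSymmBilinOn_coneInner d α).existsUnique_isOrthProj (conePoly_le_coneL2 hα)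
    (fun P hP h => eq_zero_of_integral_sq_eq_zero hα hP ?_) hf
  rw [coneInner_eq] at h
  exact (mul_eq_zero.1 h).resolve_left (coneConst_pos hα).ne'

/-! ### Additivity of `∂_t^k` near the cone -/

/-- No continuity of the top derivative is assumed, so the induction uses equality on a
neighbourhood and differentiates once more. -/
theorem iteratedDeriv_add_of_differentiableAt {S : Set ℝ} (hS : IsOpen S) {s : ℕ} {f g : ℝ → ℝ}
    (hf : ∀ v ∈ S, ∀ k < s, DifferentiableAt ℝ (iteratedDeriv k f) v)
    (hg : ∀ v ∈ S, ∀ k < s, DifferentiableAt ℝ (iteratedDeriv k g) v) :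
    ∀ k ≤ s, ∀ v ∈ S,
      iteratedDeriv k (f + g) v = iteratedDeriv k f v + iteratedDeriv k g v := by
  intro k
  induction k with
  | zero => intro _ v _; simp
  | succ k ih =>
    intro hk v hv
    have heq : iteratedDeriv k (f + g) =ᶠ[nhds v] iteratedDeriv k f + iteratedDeriv k g := by
      filter_upwards [hS.mem_nhds hv] with w hw using ih (by omega) w hw
    simp only [iteratedDeriv_succ]
    rw [heq.deriv_eq, deriv_add (hf v hv k (by omega)) (hg v hv k (by omega))]

theorem isOpen_slice {X : Type*} [TopologicalSpace X] {U : Set (X × ℝ)} (hU : IsOpen U) (x : X) :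
    IsOpen {v : ℝ | (x, v) ∈ U} :=
  hU.preimage (by fun_prop : Continuous fun v : ℝ => (x, v))

namespace TDifferentiableNearCone

variable {d s : ℕ} {f g : ConeFun d}

theorem tDeriv_add (hf : TDifferentiableNearCone s f) (hg : TDifferentiableNearCone s g) {k : ℕ}
    (hk : k ≤ s) {z : EuclideanSpace ℝ (Fin d) × ℝ} (hz : ‖z.1‖ = z.2 ∧ 0 < z.2 ∧ z.2 ≤ 1) :
    tDeriv k (f + g) z = tDeriv k f z + tDeriv k g z := by
  obtain ⟨U, hU, hUc, hUf⟩ := hf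
  obtain ⟨V, hV, hVc, hVg⟩ := hg
  exact iteratedDeriv_add_of_differentiableAt (isOpen_slice (hU.inter hV) z.1)
    (fun v hv => hUf (z.1, v) hv.1) (fun v hv => hVg (z.1, v) hv.2) k hk z.2
    ⟨hUc z hz.1 hz.2.1 hz.2.2, hVc z hz.1 hz.2.1 hz.2.2⟩

theorem add (hf : TDifferentiableNearCone s f) (hg : TDifferentiableNearCone s g) :
    TDifferentiableNearCone s (f + g) := by
  obtain ⟨U, hU, hUc, hUf⟩ := hf
  obtain ⟨V, hV, hVc, hVg⟩ := hg
  refine ⟨U ∩ V, hU.inter hV, fun z h1 h2 h3 => ⟨hUc z h1 h2 h3, hVc z h1 h2 h3⟩,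
    fun z hz k hk => ?_⟩
  have hopen := isOpen_slice (hU.inter hV) z.1
  refine ((hUf z hz.1 k hk).add (hVg z hz.2 k hk)).congr_of_eventuallyEq ?_
  filter_upwards [hopen.mem_nhds hz] with v hv
  exact iteratedDeriv_add_of_differentiableAt hopen (fun v hv => hUf (z.1, v) hv.1)
    (fun v hv => hVg (z.1, v) hv.2) k hk.le v hv

theorem smul (c : ℝ) (hf : TDifferentiableNearCone s f) : TDifferentiableNearCone s (c • f) := by
  obtain ⟨U, hU, hUc, hUf⟩ := hf
  refine ⟨U, hU, hUc, fun z hz k hk => ?_⟩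
  have h : iteratedDeriv k (fun v : ℝ => (c • f) (z.1, v)) =
      c • iteratedDeriv k fun v : ℝ => f (z.1, v) :=
    funext fun v => iteratedDeriv_const_smul_field c _
  rw [h]
  exact (hUf z hz k hk).const_smul c

theorem of_mem_conePoly {n : ℕ} (hf : f ∈ conePoly d n) : TDifferentiableNearCone s f := by
  refine ⟨Set.univ, isOpen_univ, fun _ _ _ _ => trivial, fun z _ k _ => ?_⟩
  exact ((contDiff_slice_of_mem_conePoly (tDeriv_mem_conePoly hf k) z.1 1).differentiable
    one_ne_zero).differentiableAt

end TDifferentiableNearCone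

theorem sphere_mem_cone {d : ℕ} (ξ : Metric.sphere (0 : EuclideanSpace ℝ (Fin d)) 1) :
    ‖(ξ : EuclideanSpace ℝ (Fin d))‖ = 1 ∧ (0 : ℝ) < 1 ∧ (1 : ℝ) ≤ 1 :=
  ⟨norm_eq_of_mem_sphere ξ, one_pos, le_rfl⟩

/-! ### The Sobolev form and its projections -/

/-- The restriction of `∂_t^k f` to the rim `t = 1` of the conic surface. -/
def rimTrace {d : ℕ} (k : ℕ) (f : ConeFun d) :
    Metric.sphere (0 : EuclideanSpace ℝ (Fin d)) 1 → ℝ :=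
  fun ξ => tDeriv k f ((ξ : EuclideanSpace ℝ (Fin d)), 1)

theorem rimTrace_add {d s k : ℕ} {f g : ConeFun d} (hf : TDifferentiableNearCone s f)
    (hg : TDifferentiableNearCone s g) (hk : k ≤ s) :
    rimTrace k (f + g) = rimTrace k f + rimTrace k g :=
  funext fun ξ => hf.tDeriv_add hg hk (sphere_mem_cone ξ)

theorem rimTrace_smul {d : ℕ} (k : ℕ) (c : ℝ) (f : ConeFun d) :
    rimTrace k (c • f) = c • rimTrace k f := by
  ext ξ; simp [rimTrace, tDeriv_smul]

theorem tDeriv_add_ae {d s : ℕ} {f g : ConeFun d} (hf : TDifferentiableNearCone s f)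
    (hg : TDifferentiableNearCone s g) (α : ℝ) :
    tDeriv s (f + g) =ᵐ[weightedConeMeasure d α] tDeriv s f + tDeriv s g := by
  filter_upwards [ae_mem_cone_weighted d α] with z hz using hf.tDeriv_add hg le_rfl hz

/-- The functions for which the Sobolev inner product is finite. -/
def sobolevSpace (d s : ℕ) (α : ℝ) : Submodule ℝ (ConeFun d) where
  carrier := {f | TDifferentiableNearCone s f ∧
    (∀ k < s, MemLp (rimTrace k f) 2 (sphereMeasure d)) ∧
    MemLp (tDeriv s f) 2 (weightedConeMeasure d α)}
  add_mem' := fun ⟨hf, hfr, hfi⟩ ⟨hg, hgr, hgi⟩ => ⟨hf.add hg,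
    fun k hk => by rw [rimTrace_add hf hg hk.le]; exact (hfr k hk).add (hgr k hk),
    (hfi.add hgi).ae_eq (tDeriv_add_ae hf hg α).symm⟩
  zero_mem' := ⟨.of_mem_conePoly (Submodule.zero_mem (conePoly d 0)),
    fun k _ => by
      have h : rimTrace k (0 : ConeFun d) = 0 := by ext ξ; simp [rimTrace, tDeriv_zero_right]
      rw [h]; exact MemLp.zero,
    by rw [tDeriv_zero_right]; exact MemLp.zero⟩
  smul_mem' := fun c f ⟨hf, hfr, hfi⟩ => ⟨hf.smul c,
    fun k hk => by rw [rimTrace_smul]; exact (hfr k hk).const_smul c,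
    by rw [tDeriv_smul]; exact hfi.const_smul c⟩

theorem sobolevInner_eq {d : ℕ} (s : ℕ) (β : ℝ) (lam : ℕ → ℝ) (f g : ConeFun d) :
    sobolevInner s β lam f g =
      (1 / sphereArea d) * (∫ z, tDeriv s f z * tDeriv s g z ∂weightedConeMeasure d (β + s)) +
      ∑ k ∈ Finset.range s, (lam k / sphereArea d) *
        ∫ ξ, rimTrace k f ξ * rimTrace k g ξ ∂sphereMeasure d := by
  simp only [sobolevInner, integral_mul_rpow_coneMeasure, rimTrace]

theorem isSymmBilinOn_sobolevInner (d s : ℕ) (β : ℝ) (lam : ℕ → ℝ) :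
    IsSymmBilinOn (sobolevInner s β lam) (sobolevSpace d s (β + s)) where
  symm := fun f _ g _ => by simp only [sobolevInner, mul_comm]
  add_left := fun f ⟨hf, hfr, hfi⟩ g ⟨hg, hgr, hgi⟩ h ⟨_, hhr, hhi⟩ => by
    have h1 : ∫ z, tDeriv s (f + g) z * tDeriv s h z ∂weightedConeMeasure d (β + s) =
        (∫ z, tDeriv s f z * tDeriv s h z ∂weightedConeMeasure d (β + s)) +
          ∫ z, tDeriv s g z * tDeriv s h z ∂weightedConeMeasure d (β + s) := by
      have := integral_add (hfi.integrable_mul hhi) (hgi.integrable_mul hhi)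
      simp only [Pi.mul_apply] at this
      rw [← this]
      refine integral_congr_ae ?_
      filter_upwards [tDeriv_add_ae hf hg (β + s)] with z hz
      simp only [hz, Pi.add_apply, add_mul]
    have h2 : ∀ k ∈ Finset.range s, (lam k / sphereArea d) *
        ∫ ξ, rimTrace k (f + g) ξ * rimTrace k h ξ ∂sphereMeasure d =
        (lam k / sphereArea d) * (∫ ξ, rimTrace k f ξ * rimTrace k h ξ ∂sphereMeasure d) +
          (lam k / sphereArea d) * ∫ ξ, rimTrace k g ξ * rimTrace k h ξ ∂sphereMeasure d := by
      intro k hk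
      have hk' := Finset.mem_range.1 hk
      have := integral_add ((hfr k hk').integrable_mul (hhr k hk'))
        ((hgr k hk').integrable_mul (hhr k hk'))
      simp only [Pi.mul_apply] at this
      rw [← mul_add, ← this, rimTrace_add hf hg hk'.le]
      simp only [Pi.add_apply, add_mul]
    rw [sobolevInner_eq, sobolevInner_eq, sobolevInner_eq, h1, Finset.sum_congr rfl h2,
      Finset.sum_add_distrib]
    ring
  smul_left := fun c f _ h _ => by
    simp only [sobolevInner_eq, tDeriv_smul, rimTrace_smul, Pi.smul_apply, smul_eq_mul, mul_assoc,
      integral_const_mul, mul_add, Finset.mul_sum]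
    simp only [mul_left_comm c]

theorem continuous_rimTrace {d n : ℕ} {P : ConeFun d} (hP : P ∈ conePoly d n) (k : ℕ) :
    Continuous (rimTrace k P) :=
  (continuous_of_mem_conePoly (tDeriv_mem_conePoly hP k)).comp (by fun_prop)

theorem memLp_rimTrace {d n : ℕ} {P : ConeFun d} (hP : P ∈ conePoly d n) (k : ℕ) :
    MemLp (rimTrace k P) 2 (sphereMeasure d) := by
  have hc := continuous_rimTrace hP k
  obtain ⟨C, hC⟩ := isCompact_univ.exists_bound_of_continuousOn hc.continuousOn
  exact MemLp.of_bound hc.aestronglyMeasurable C (.of_forall fun ξ => hC ξ trivial)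

theorem conePoly_le_sobolevSpace {d : ℕ} [NeZero d] (s : ℕ) {α : ℝ} (hα : -(d : ℝ) < α) (n : ℕ) :
    conePoly d n ≤ sobolevSpace d s α := fun _ hP =>
  ⟨.of_mem_conePoly hP, fun k _ => memLp_rimTrace hP k,
    memLp_of_mem_conePoly hα (tDeriv_mem_conePoly hP s)⟩

/-- All terms are nonnegative, so each vanishes: `∂_t^s P = 0`, and the rim traces vanish on the
unit sphere. Harmonicity extends the latter to all `x`, as descending through the `t`-derivatives
requires. -/
theorem eq_zero_of_sobolevInner_self {d s n : ℕ} [NeZero d] {β : ℝ} (hβ : -(d : ℝ) < β + s)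
    {lam : ℕ → ℝ} (hlam : ∀ k < s, 0 < lam k) {P : ConeFun d} (hP : P ∈ conePoly d n)
    (h : sobolevInner s β lam P P = 0) : P = 0 := by
  have hω := sphereArea_pos d
  have hterm : ∀ k ∈ Finset.range s, 0 ≤ (lam k / sphereArea d) *
      ∫ ξ, rimTrace k P ξ * rimTrace k P ξ ∂sphereMeasure d := fun k hk =>
    mul_nonneg (div_pos (hlam k (Finset.mem_range.1 hk)) hω).le
      (integral_nonneg fun ξ => mul_self_nonneg _)
  rw [sobolevInner_eq, add_eq_zero_iff_of_nonneg (mul_nonneg (one_div_pos.2 hω).le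
    (integral_nonneg fun z => mul_self_nonneg _)) (Finset.sum_nonneg hterm)] at h
  refine eq_zero_of_tDeriv_eq_zero hP (eq_zero_of_integral_sq_eq_zero hβ
    (tDeriv_mem_conePoly hP s) ((mul_eq_zero.1 h.1).resolve_left (one_div_pos.2 hω).ne')) ?_
  intro k hk
  have hint := (mul_eq_zero.1 ((Finset.sum_eq_zero_iff_of_nonneg hterm).1 h.2 k
    (Finset.mem_range.2 hk))).resolve_left (div_pos (hlam k hk) hω).ne'
  have hL := memLp_rimTrace hP k
  have hae := (integral_eq_zero_iff_of_nonneg (fun ξ => mul_self_nonneg (rimTrace k P ξ))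
    (hL.integrable_mul hL)).1 hint
  have hc := continuous_rimTrace hP k
  have hzero := ((hc.mul hc).ae_eq_iff_eq (sphereMeasure d) continuous_const).1 hae
  exact conePoly_eq_zero_of_sphere (tDeriv_mem_conePoly hP k) one_pos fun x hx =>
    mul_self_eq_zero.1 (congrFun hzero ⟨x, by simpa using hx⟩)

theorem existsUnique_isSobolevProj {d s : ℕ} [NeZero d] {β : ℝ} (hβ : -(d : ℝ) < β + s)
    {lam : ℕ → ℝ} (hlam : ∀ k < s, 0 < lam k) (n : ℕ) {f : ConeFun d}
    (hf : f ∈ sobolevSpace d s (β + s)) : ∃! P, IsSobolevProj s β lam n f P :=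
  (isSymmBilinOn_sobolevInner d s β lam).existsUnique_isOrthProj (conePoly_le_sobolevSpace s hβ)
    (fun _ hP h => eq_zero_of_sobolevInner_self hβ hlam hP h) hf

/-! ### Transfer between the two forms by `∂_t^s` -/

/-- If one argument vanishes to order `s` on the rim, the Sobolev inner product is a multiple of
the weighted inner product of the `s`-th derivatives. -/
theorem coneInner_tDeriv_eq {d s : ℕ} [NeZero d] (β : ℝ) (lam : ℕ → ℝ)
    (f : ConeFun d) {G : ConeFun d} (hG : ∀ k < s, ∀ x, tDeriv k G (x, 1) = 0) :
    coneInner (β + s) 0 (tDeriv s f) (tDeriv s G) =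
      coneConst d (β + s) 0 * sphereArea d * sobolevInner s β lam f G := by
  have hrim : ∀ k ∈ Finset.range s, (lam k / sphereArea d) *
      ∫ ξ, rimTrace k f ξ * rimTrace k G ξ ∂sphereMeasure d = 0 := fun k hk => by
    simp [rimTrace, hG k (Finset.mem_range.1 hk)]
  rw [sobolevInner_eq, Finset.sum_eq_zero hrim, coneInner_eq]
  field_simp [(sphereArea_pos d).ne']
  simp

theorem tDeriv_mem_orthPoly {d s n : ℕ} [NeZero d] {β : ℝ} {lam : ℕ → ℝ} (hn : s ≤ n)
    {P : ConeFun d} (hP : P ∈ orthPoly (sobolevInner s β lam) n) :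
    tDeriv s P ∈ orthPoly (coneInner (β + s) 0) (n - s) := by
  refine ⟨tDeriv_mem_conePoly hP.1 s, fun k hk q hq => ?_⟩
  -- The test polynomial is lifted to a rim-flat one of degree at most `k + s < n`, to which Sobolev
  -- orthogonality applies.
  obtain ⟨G, hG, rfl, hG0⟩ := exists_tDeriv_eq s hq
  rw [coneInner_tDeriv_eq β lam P hG0, hP.2 (k + s) (by omega) G hG, mul_zero]

theorem exists_mem_orthPoly_tDeriv_eq {d s n : ℕ} [NeZero d] {β : ℝ} (hβ : -(d : ℝ) < β + s)
    {lam : ℕ → ℝ} (hn : s ≤ n) {Q : ConeFun d} (hQ : Q ∈ orthPoly (coneInner (β + s) 0) (n - s)) :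
    ∃ G ∈ orthPoly (sobolevInner s β lam) n, tDeriv s G = Q ∧
      ∀ k < s, ∀ x, tDeriv k G (x, 1) = 0 := by
  obtain ⟨G, hG, hGQ, hG0⟩ := exists_tDeriv_eq s hQ.1
  rw [Nat.sub_add_cancel hn] at hG
  refine ⟨G, ⟨hG, fun k hk q hq => ?_⟩, hGQ, hG0⟩
  have hV := conePoly_le_sobolevSpace s hβ
  have hc : coneConst d (β + s) 0 * sphereArea d ≠ 0 :=
    (mul_pos (coneConst_pos hβ) (sphereArea_pos d)).ne'
  have hQA := conePoly_le_coneL2 hβ _ hQ.1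
  have key : coneInner (β + s) 0 (tDeriv s q) Q = 0 := by
    -- For `k < s` the truncated `k - s` need not be below `n - s` (take `n = s`), but there `∂_t^s
    -- q` is zero.
    rcases lt_or_ge k s with h | h
    · rw [tDeriv_eq_zero_of_lt hq h, (isSymmBilinOn_coneInner d _).zero_left hQA]
    · have hq' := tDeriv_mem_conePoly hq s
      rw [(isSymmBilinOn_coneInner d _).symm _ (conePoly_le_coneL2 hβ _ hq') _ hQA]
      exact hQ.2 (k - s) (by omega) _ hq'
  rw [← hGQ, coneInner_tDeriv_eq β lam q hG0] at key
  rw [(isSymmBilinOn_sobolevInner d s β lam).symm _ (hV _ hG) _ (hV _ hq)]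
  exact (mul_eq_zero.1 key).resolve_left hc

/-- Only rim-flat lifts of the test polynomials are needed, so the rim values of `f` and `P` never
enter the weighted pairing. -/
theorem isConeProj_tDeriv {d s n : ℕ} [NeZero d] {β : ℝ} (hβ : -(d : ℝ) < β + s)
    {lam : ℕ → ℝ} (hn : s ≤ n) {f P : ConeFun d} (hf : f ∈ sobolevSpace d s (β + s))
    (hP : IsSobolevProj s β lam n f P) :
    IsConeProj (β + s) 0 (n - s) (tDeriv s f) (tDeriv s P) := by
  refine ⟨tDeriv_mem_orthPoly hn hP.1, fun Q hQ => ?_⟩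
  obtain ⟨G, hG, rfl, hG0⟩ := exists_mem_orthPoly_tDeriv_eq (lam := lam) hβ hn hQ
  have hPA := conePoly_le_sobolevSpace s hβ _ hP.1.1
  have hGA := conePoly_le_sobolevSpace s hβ _ hG.1
  have hsob := hP.2 G hG
  rw [(isSymmBilinOn_sobolevInner d s β lam).sub_left hf hPA hGA] at hsob
  rw [(isSymmBilinOn_coneInner d _).sub_left hf.2.2 hPA.2.2 hGA.2.2,
    coneInner_tDeriv_eq β lam f hG0, coneInner_tDeriv_eq β lam P hG0, ← mul_sub, hsob, mul_zero]

end

theorem mainTheorem5 (d : ℕ) (hd : 1 ≤ d) (s : ℕ) (hs : 1 ≤ s) (β : ℝ)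
    (hβ : -(d : ℝ) - (s : ℝ) < β) (lam : ℕ → ℝ) (hlam : ∀ k < s, 0 < lam k)
    (f : ConeFun d) (hf : TDifferentiableNearCone s f)
    (hrim : ∀ k < s, MemLp (fun ξ : Metric.sphere (0 : EuclideanSpace ℝ (Fin d)) 1 =>
      tDeriv k f ((ξ : EuclideanSpace ℝ (Fin d)), 1)) 2 (sphereMeasure d))
    (hL2 : MemL2Cone (β + (s : ℝ)) 0 (tDeriv s f))
    (n : ℕ) (hn : s ≤ n) :
    (∃! P : ConeFun d, IsSobolevProj s β lam n f P) ∧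
      (∃! Q : ConeFun d, IsConeProj (β + (s : ℝ)) 0 (n - s) (tDeriv s f) Q) ∧
      ∀ P Q : ConeFun d, IsSobolevProj s β lam n f P →
        IsConeProj (β + (s : ℝ)) 0 (n - s) (tDeriv s f) Q → tDeriv s P = Q := by
  have : NeZero d := ⟨by omega⟩
  have hα : -(d : ℝ) < β + s := by linarith
  have hfA : f ∈ sobolevSpace d s (β + s) := ⟨hf, hrim, hL2⟩
  have hQ := existsUnique_isConeProj hα (n - s) hL2
  exact ⟨existsUnique_isSobolevProj hα hlam n hfA, hQ,
    fun P Q hPp hQp => hQ.unique (isConeProj_tDeriv hα hn hfA hPp) hQp⟩
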